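/- There is a universal constant $C>0$ such that the following holds. Let $(\mathcal M,\tau)$ be a tracial von Neumann algebra, i.e. a von Neumann algebra $\mathcal M$ (acting on some Hilbert space) together with a normal faithful tracial state $\tau$, and write $\|x\|_\tau=\tau(x^*x)^{1/2}$ for $x\in\mathcal M$. Let $k\ge 0$ be an integer, $\varepsilon\in\mathbb R$, and let $\phi:\mathbb Z_2^k\to\mathcal U(\mathcal M)$ be any map to the unitary group of $\mathcal M$ such that \[ \mathbb E_{x,y\in\mathbb Z_2^k}\big\|\phi(x)\phi(y)-\phi(x+y)\big\|_\tau^2\le\varepsilon , \] where $\mathbb E$ denotes the average over uniformly random elements. Then there is a projective measurement $\{P_u\}_{u\in\mathbb Z_2^k}$ on $\mathcal M$, i.e. a family of orthogonal projections $P_u\in\mathcal M$ with $\sum_u P_u=1$, such that \[ \mathbb E_{x\in\mathbb Z_2^k}\Big\|\phi(x)-\sum_{u\in\mathbb Z_2^k}(-1)^{u\cdot x}P_u\Big\|_\tau^2\le C\,\varepsilon , \] where $u\cdot x=\sum_i u_ix_i \bmod 2$. The constant $C$ does not depend on $k$, $\mathcal M$, $\tau$, $\phi$ or $\varepsilon$.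 -/

import Mathlib

open scoped BigOperators

namespace LinTest

universe u

variable {H : Type u} [NormedAddCommGroup H] [InnerProductSpace ℂ H] [CompleteSpace H]

/-- A von Neumann algebra is closed under multiplication by complex scalars, so its underlying type
is a complex vector space. -/
instance instSMulMemClass : SMulMemClass (VonNeumannAlgebra H) ℂ (H →L[ℂ] H) where
  smul_mem {S} c _ hx := S.toStarSubalgebra.toSubalgebra.smul_mem hx c

/-- A linear functional on a von Neumann algebra `M` is normal if it preserves the suprema of
bounded increasing nets of positive elements; `M` carries the order of operators
(`x ≤ y` iff `y - x` is a positive operator). This is used for positive functionals only, which take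
real values on positive elements. -/
def IsNormal (M : VonNeumannAlgebra H) (τ : M →ₗ[ℂ] ℂ) : Prop :=
  ∀ (S : Set M) (a : M), S.Nonempty → DirectedOn (· ≤ ·) S → (∀ x ∈ S, 0 ≤ x) →
    IsLUB S a → IsLUB ((fun x : M => (τ x).re) '' S) (τ a).re

open scoped ComplexOrder in
/-- `τ` is a normal faithful tracial state on `M`, that is, `(M, τ)` is a tracial von Neumann
algebra. -/
structure IsNormalFaithfulTracialState (M : VonNeumannAlgebra H) (τ : M →ₗ[ℂ] ℂ) : Prop where
  nonneg : ∀ x : M, 0 ≤ x → 0 ≤ τ x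
  map_one : τ 1 = 1
  tracial : ∀ x y : M, τ (x * y) = τ (y * x)
  faithful : ∀ x : M, τ (star x * x) = 0 → x = 0
  normal : IsNormal M τ

/-- The 2-norm `‖x‖_τ = τ(x* x)^{1/2}`. -/
noncomputable def tauNorm (M : VonNeumannAlgebra H) (τ : M →ₗ[ℂ] ℂ) (x : M) : ℝ :=
  Real.sqrt (τ (star x * x)).re

/-- A measurement on `M` with a finite outcome set `A`. -/
structure IsMeasurement (M : VonNeumannAlgebra H) {A : Type*} [Fintype A] (P : A → M) : Prop where
  nonneg : ∀ a, 0 ≤ P a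
  sum_eq_one : ∑ a, P a = 1

/-- A measurement is projective if all its operators are (orthogonal) projections. -/
structure IsProjectiveMeasurement (M : VonNeumannAlgebra H) {A : Type*} [Fintype A]
    (P : A → M) : Prop extends IsMeasurement M P where
  isStarProjection : ∀ a, IsStarProjection (P a)

/-- The sign `(-1)^{u · x}` for `u, x ∈ ℤ₂ᵏ`, where `u · x` is the inner product modulo 2. -/
def sign {k : ℕ} (u x : Fin k → ZMod 2) : ℂ :=
  (-1) ^ (u ⬝ᵥ x).val

/-- The operator `∑_u (-1)^{u · x} P_u`. -/
noncomputable def observable (M : VonNeumannAlgebra H) {k : ℕ} (P : (Fin k → ZMod 2) → M)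
    (x : Fin k → ZMod 2) : M :=
  ∑ u, sign u x • P u

end LinTest

/-! If φ is a homomorphism, its Fourier coefficients a_u = E_x (-1)^{u·x} φ(x) are already the
required projections. In general, Parseval for φ and for φ* gives Σ a_u* a_u = Σ a_u a_u* = 1, and
expanding the squared norm turns the hypothesis into Re Σ τ(a_u* a_u a_u) ≥ 1 - ε/2. Split a_u = b_u
+ e_u into self-adjoint and skew-adjoint parts. Then Σ (b_u² - e_u²) = 1 and the cubic sum has real
part Σ τ((b_u² - e_u²) b_u). Near equality makes Σ τ(b_u² (1 - b_u)) and Σ ‖e_u‖² of order ε, so b_u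
is concentrated near 0 and 1. Its spectral projection p_u for (1/2, ∞) is then close to a_u, and p_u
≤ 4 b_u² bounds the total overlap Σ_{u≠v} τ(p_u p_v) by O(ε) (`IsTrace.rounding`).

It remains to make the p_u orthogonal with a loss linear in the overlap
(`exists_orthogonal_projections`). Shrink them to q_u with linearly independent ranges and the same
closed span, and take the polar decomposition q_u = h V_u of the row operator (q_u)_u. Independence
makes the V_u partial isometries with orthogonal ranges; the projections V_u V_u* replace p_u. The
missing mass goes to outcome 0, and Parseval translates closeness of coefficients into the claim. -/

namespace LinTest

/-! ### Projections, factorization and polar decomposition in a von Neumann algebra. -/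

section Operators

variable {H : Type*} [NormedAddCommGroup H] [InnerProductSpace ℂ H] [CompleteSpace H]

lemma mem_of_forall_commute (M : VonNeumannAlgebra H) {x : H →L[ℂ] H}
    (h : ∀ y ∈ M.commutant, x * y = y * x) : x ∈ M := by
  rw [← VonNeumannAlgebra.commutant_commutant M, VonNeumannAlgebra.mem_commutant_iff]
  exact fun g hg => (h g hg).symm

lemma commute_of_mem_commutant {M : VonNeumannAlgebra H} {x y : H →L[ℂ] H}
    (hx : x ∈ M) (hy : y ∈ M.commutant) : x * y = y * x :=
  VonNeumannAlgebra.mem_commutant_iff.1 hy x hx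

lemma starProjection_mem (M : VonNeumannAlgebra H) (K : Submodule ℂ H)
    [K.HasOrthogonalProjection] (hK : ∀ y ∈ M.commutant, ∀ ξ ∈ K, y ξ ∈ K) :
    K.starProjection ∈ M := by
  rw [VonNeumannAlgebra.IsStarProjection.mem_iff isStarProjection_starProjection]
  intro y hy
  rw [Submodule.range_starProjection]
  exact hK y hy

/-- The projection onto the closed span of the ranges of finitely many elements. -/
lemma exists_join_projection (M : VonNeumannAlgebra H) {ι : Type*} (s : Finset ι)
    (x : ι → H →L[ℂ] H) (hx : ∀ i ∈ s, x i ∈ M) :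
    ∃ r ∈ M, IsStarProjection r ∧ (∀ i ∈ s, r * x i = x i) ∧
      ∀ y : H →L[ℂ] H, (∀ i ∈ s, y * x i = 0) → y * r = 0 := by
  set K : Submodule ℂ H := (⨆ i ∈ s, (x i).range).topologicalClosure with hKdef
  have : CompleteSpace K := (Submodule.isClosed_topologicalClosure _).completeSpace_coe
  have hle : ∀ i ∈ s, (x i).range ≤ K := fun i hi =>
    (le_iSup₂_of_le (f := fun i (_ : i ∈ s) => (x i).range) i hi le_rfl).trans
      (Submodule.le_topologicalClosure _)
  refine ⟨K.starProjection, starProjection_mem M K ?_, isStarProjection_starProjection, ?_, ?_⟩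
  · intro y hy
    have hcl : IsClosed ((K.comap y.toLinearMap : Submodule ℂ H) : Set H) :=
      (Submodule.isClosed_topologicalClosure _).preimage y.continuous
    have : K ≤ K.comap y.toLinearMap := by
      refine Submodule.topologicalClosure_minimal _ (iSup₂_le fun i hi => ?_) hcl
      rintro _ ⟨ξ, rfl⟩
      refine hle i hi ⟨y ξ, ?_⟩
      exact congrArg (fun z : H →L[ℂ] H => z ξ) (commute_of_mem_commutant (hx i hi) hy)
    exact fun ξ hξ => this hξ
  · intro i hi
    ext ξ
    exact Submodule.starProjection_eq_self_iff.2 (hle i hi ⟨ξ, rfl⟩)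
  · intro y hy
    have hcl : IsClosed ((y.ker : Submodule ℂ H) : Set H) := y.isClosed_ker
    have : K ≤ y.ker := by
      refine Submodule.topologicalClosure_minimal _ (iSup₂_le fun i hi => ?_) hcl
      rintro _ ⟨ξ, rfl⟩
      exact congrArg (fun z : H →L[ℂ] H => z ξ) (hy i hi)
    ext ξ
    exact this (Submodule.starProjection_apply_mem K ξ)

lemma exists_range_projection (M : VonNeumannAlgebra H) {x : H →L[ℂ] H} (hx : x ∈ M) :
    ∃ r ∈ M, IsStarProjection r ∧ r * x = x ∧ ∀ y : H →L[ℂ] H, y * x = 0 → y * r = 0 := by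
  obtain ⟨r, hr, hp, h1, h2⟩ := exists_join_projection M (Finset.univ : Finset Unit)
    (fun _ => x) (fun _ _ => hx)
  exact ⟨r, hr, hp, h1 () (Finset.mem_univ _), fun y hy => h2 y fun _ _ => hy⟩

lemma exists_inf_projection (M : VonNeumannAlgebra H) {e f : H →L[ℂ] H} (he : e ∈ M)
    (hf : f ∈ M) :
    ∃ g ∈ M, IsStarProjection g ∧ e * g = g ∧ f * g = g ∧
      ∀ ξ, e ξ = ξ → f ξ = ξ → g ξ = ξ := by
  set K : Submodule ℂ H := (e - 1).ker ⊓ (f - 1).ker with hK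
  have hcl : IsClosed (K : Set H) := (e - 1).isClosed_ker.inter (f - 1).isClosed_ker
  have : CompleteSpace K := hcl.completeSpace_coe
  have hmem : ∀ ξ, ξ ∈ K ↔ e ξ = ξ ∧ f ξ = ξ := fun ξ => by
    simp [hK, sub_eq_zero]
  refine ⟨K.starProjection, starProjection_mem M K ?_, isStarProjection_starProjection, ?_, ?_, ?_⟩
  · intro y hy ξ hξ
    rw [hmem] at hξ ⊢
    have h1 := congrArg (fun z : H →L[ℂ] H => z ξ) (commute_of_mem_commutant he hy)
    have h2 := congrArg (fun z : H →L[ℂ] H => z ξ) (commute_of_mem_commutant hf hy)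
    simp only [mul_apply_eq_comp, hξ.1, hξ.2] at h1 h2
    exact ⟨h1, h2⟩
  · ext ξ
    exact ((hmem _).1 (Submodule.starProjection_apply_mem K ξ)).1
  · ext ξ
    exact ((hmem _).1 (Submodule.starProjection_apply_mem K ξ)).2
  · exact fun ξ h1 h2 => Submodule.starProjection_eq_self_iff.2 ((hmem ξ).2 ⟨h1, h2⟩)

/-- Every self-adjoint element has a spectral projection for `(0, ∞)`. -/
lemma exists_positive_projection (M : VonNeumannAlgebra H) {x : H →L[ℂ] H} (hx : x ∈ M)
    (hsa : IsSelfAdjoint x) :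
    ∃ p ∈ M, IsStarProjection p ∧ p * x = x * p ∧ 0 ≤ p * x ∧ 0 ≤ (1 - p) * (-x) := by
  have hpos : x⁺ ∈ M := by
    refine mem_of_forall_commute M fun y hy => ?_
    have h : Commute x y := commute_of_mem_commutant hx hy
    rw [CFC.posPart_def]
    exact h.cfcₙ_real _
  obtain ⟨p, hp, hproj, h1, h2⟩ := exists_range_projection M hpos
  -- Since x⁻ x⁺ = 0, x⁻ vanishes on the closed range of x⁺; hence p cuts x into x⁺ and -x⁻.
  have hn : x⁻ * p = 0 := h2 _ (CFC.negPart_mul_posPart x)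
  have hn' : p * x⁻ = 0 := by
    have := congrArg star hn
    rwa [star_mul, star_zero, hproj.isSelfAdjoint.star_eq,
      (IsSelfAdjoint.of_nonneg (CFC.negPart_nonneg x)).star_eq] at this
  have h1' : x⁺ * p = x⁺ := by
    have := congrArg star h1
    rwa [star_mul, hproj.isSelfAdjoint.star_eq,
      (IsSelfAdjoint.of_nonneg (CFC.posPart_nonneg x)).star_eq] at this
  have hx' : x⁺ - x⁻ = x := CFC.posPart_sub_negPart x hsa
  have hpx : p * x = x⁺ := by
    conv_lhs => rw [← hx']
    rw [mul_sub, hn', sub_zero, h1]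
  have hxp : x * p = x⁺ := by
    conv_lhs => rw [← hx']
    rw [sub_mul, hn, sub_zero, h1']
  refine ⟨p, hp, hproj, hpx.trans hxp.symm, hpx ▸ CFC.posPart_nonneg x, ?_⟩
  have : (1 - p) * (-x) = x⁻ := by
    rw [sub_mul, one_mul, mul_neg, hpx, sub_neg_eq_add, neg_add_eq_sub,
      sub_eq_iff_eq_add, ← sub_eq_iff_eq_add']
    exact hx'
  rw [this]
  exact CFC.negPart_nonneg x

/-- Douglas factorization inside a von Neumann algebra. -/
lemma exists_factor (M : VonNeumannAlgebra H) {h p s : H →L[ℂ] H} (hh : h ∈ M) (hp : p ∈ M)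
    (hs : s ∈ M) (hsp : IsStarProjection s) (hsh : s * h = h)
    (hmin : ∀ y : H →L[ℂ] H, y * h = 0 → y * s = 0) (hle : ∀ ξ, ‖p ξ‖ ≤ ‖h ξ‖) :
    ∃ W ∈ M, W * h = p ∧ W * s = W := by
  set K : Submodule ℂ H := h.range.topologicalClosure with hK
  have : CompleteSpace K := (Submodule.isClosed_topologicalClosure _).completeSpace_coe
  let e : H →ₗ[ℂ] K := h.toLinearMap.codRestrict K
    (fun ξ => Submodule.le_topologicalClosure _ ⟨ξ, rfl⟩)
  have hdense : DenseRange e := by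
    rw [DenseRange, Subtype.dense_iff]
    intro ξ hξ
    have : Subtype.val '' Set.range e = (h.range : Set H) := by
      ext; simp [e]
    have hξ' : ξ ∈ closure (h.range : Set H) := hξ
    rw [← this] at hξ'
    exact hξ'
  have hnorm : ∀ ξ, ‖p.toLinearMap ξ‖ ≤ 1 * ‖e ξ‖ := fun ξ => by
    simpa [e] using hle ξ
  let W₀ : K →L[ℂ] H := p.toLinearMap.extendOfNorm e
  let W₁ : H →L[ℂ] H := W₀ ∘L K.orthogonalProjectionOnto
  have hW₁ : W₁ * h = p := by
    ext ξ
    have h1 : K.orthogonalProjectionOnto (h ξ) = e ξ :=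
      Submodule.orthogonalProjectionOnto_mem_subspace_eq_self (e ξ)
    change W₀ (K.orthogonalProjectionOnto (h ξ)) = p ξ
    rw [h1]
    exact LinearMap.extendOfNorm_eq hdense ⟨1, hnorm⟩ ξ
  have hWh : W₁ * s * h = p := by rw [mul_assoc, hsh, hW₁]
  have hss : s * s = s := hsp.isIdempotentElem
  refine ⟨W₁ * s, mem_of_forall_commute M fun y hy => ?_, hWh, by rw [mul_assoc, hss]⟩
  -- `W₁ * s` commutes with the commutant on the range of `h`, hence on that of `s`; off `s` it is
  -- zero.
  have h1 : (W₁ * s * y - y * (W₁ * s)) * s = 0 := by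
    apply hmin
    rw [sub_mul, mul_assoc _ y h, ← commute_of_mem_commutant hh hy, ← mul_assoc, hWh, mul_assoc y,
      hWh, commute_of_mem_commutant hp hy, sub_self]
  have h2 : W₁ * s * y * s = W₁ * s * y := by
    rw [mul_assoc _ y s, ← commute_of_mem_commutant hs hy, ← mul_assoc, mul_assoc W₁ s s, hss]
  rwa [sub_mul, h2, mul_assoc y, mul_assoc W₁ s s, hss, sub_eq_zero] at h1

/-- Passing to linearly independent subprojections with the same closed span. -/
lemma exists_independent_subprojections (M : VonNeumannAlgebra H) {ι : Type*} [DecidableEq ι]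
    (p : ι → H →L[ℂ] H) (hpM : ∀ i, p i ∈ M) (hp : ∀ i, IsStarProjection (p i))
    (s : Finset ι) :
    ∃ q : ι → H →L[ℂ] H, (∀ i, q i ∈ M) ∧ (∀ i, IsStarProjection (q i)) ∧
      (∀ i, p i * q i = q i) ∧
      (∀ η : ι → H, (∀ i, q i (η i) = η i) → ∑ i ∈ s, η i = 0 → ∀ i ∈ s, η i = 0) ∧
      ∀ y : H →L[ℂ] H, (∀ i ∈ s, y * q i = 0) → ∀ i ∈ s, y * p i = 0 := by
  induction s using Finset.induction_on with
  | empty => exact ⟨p, hpM, hp, fun i => (hp i).isIdempotentElem, by simp, by simp⟩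
  | insert j s hj ih =>
    obtain ⟨q, hqM, hq, hpq, hind, hspan⟩ := ih
    obtain ⟨r, hrM, hr, hrq, hrmin⟩ := exists_join_projection M s q (fun i _ => hqM i)
    obtain ⟨g, hgM, hg, hpg, hrg, hgmax⟩ := exists_inf_projection M (hpM j) hrM
    have hgp : g * p j = g := by
      have := congrArg star hpg
      rwa [star_mul, hg.isSelfAdjoint.star_eq, (hp j).isSelfAdjoint.star_eq] at this
    have hpp : p j * p j = p j := (hp j).isIdempotentElem
    have hgg : g * g = g := hg.isIdempotentElem
    have hne : ∀ i ∈ s, i ≠ j := fun i hi h => hj (h ▸ hi)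
    -- The new projection is p_j - p_j ∧ r, where r is the join of the earlier q_i: removing the
    -- overlap gives independence, and the removed part is still covered by r.
    refine ⟨Function.update q j (p j - g), ?_, ?_, ?_, ?_, ?_⟩
    · intro i
      by_cases h : i = j
      · subst h; simpa using sub_mem (hpM i) hgM
      · simpa [h] using hqM i
    · intro i
      by_cases h : i = j
      · subst h
        rw [Function.update_self]
        refine ⟨?_, (hp i).isSelfAdjoint.sub hg.isSelfAdjoint⟩
        rw [IsIdempotentElem, sub_mul, mul_sub, mul_sub, hpp, hpg, hgp, hgg, sub_self, sub_zero]
      · simpa [h] using hq i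
    · intro i
      by_cases h : i = j
      · subst h; rw [Function.update_self, mul_sub, hpp, hpg]
      · simpa [h] using hpq i
    · intro η hη hsum
      rw [Finset.sum_insert hj] at hsum
      have hηs : ∀ i ∈ s, q i (η i) = η i := fun i hi => by
        simpa [hne i hi] using hη i
      have hηj := hη j
      rw [Function.update_self] at hηj
      have hpη : p j (η j) = η j := by
        conv_lhs => rw [← hηj]
        have : p j * (p j - g) = p j - g := by rw [mul_sub, hpp, hpg]
        exact (congrArg (fun z : H →L[ℂ] H => z (η j)) this).trans hηj
      have hrη : ∀ i ∈ s, r (η i) = η i := fun i hi => by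
        conv_lhs => rw [← hηs i hi]
        exact (congrArg (fun z : H →L[ℂ] H => z (η i)) (hrq i hi)).trans (hηs i hi)
      have hrj : r (η j) = η j := by
        rw [eq_neg_of_add_eq_zero_left hsum, map_neg, map_sum, Finset.sum_congr rfl hrη]
      have hzero : η j = 0 := by
        have := hgmax _ hpη hrj
        rw [← hηj, sub_apply, hpη, this, sub_self]
      rw [hzero, zero_add] at hsum
      -- Independence of the old family also constrains the vector at `j`, where the projection has
      -- changed; the value 0 is always admissible there.
      have hrest := hind (Function.update η j 0) (fun i => by
        by_cases h : i = j
        · subst h; simp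
        · simpa [h] using hη i) (by
        rw [← hsum]
        exact Finset.sum_congr rfl fun i hi => by simp [hne i hi])
      intro i hi
      rcases Finset.mem_insert.1 hi with rfl | hi
      · exact hzero
      · simpa [hne i hi] using hrest i hi
    · intro y hy
      have hy' : ∀ i ∈ s, y * q i = 0 := fun i hi => by
        simpa [hne i hi] using hy i (Finset.mem_insert_of_mem hi)
      have hyr := hrmin y hy'
      have hyj := hy j (Finset.mem_insert_self _ _)
      rw [Function.update_self, mul_sub, sub_eq_zero] at hyj
      intro i hi
      rcases Finset.mem_insert.1 hi with rfl | hi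
      · rw [hyj, ← hrg, ← mul_assoc, hyr, zero_mul]
      · exact hspan y hy' i hi

/-- The polar decomposition of the row operator of a family of projections with independent
ranges. -/
lemma exists_polar (M : VonNeumannAlgebra H) {ι : Type*} [Fintype ι] [DecidableEq ι]
    (q : ι → H →L[ℂ] H) (hqM : ∀ i, q i ∈ M) (hq : ∀ i, IsStarProjection (q i))
    (hind : ∀ η : ι → H, (∀ i, q i (η i) = η i) → ∑ i, η i = 0 → ∀ i, η i = 0) :
    ∃ (h s : H →L[ℂ] H) (V : ι → H →L[ℂ] H), h ∈ M ∧ s ∈ M ∧ (∀ i, V i ∈ M) ∧ 0 ≤ h ∧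
      h * h = ∑ i, q i ∧ IsStarProjection s ∧ (∀ i, s * q i = q i) ∧
      (∀ y : H →L[ℂ] H, (∀ i, y * q i = 0) → y * s = 0) ∧
      h * s = h ∧ (∀ i, h * V i = q i) ∧ (∀ i j, star (V i) * V j = if i = j then q i else 0) ∧
      ∑ i, V i * star (V i) = s := by
  set S : H →L[ℂ] H := ∑ i, q i with hS
  have hS0 : 0 ≤ S := Finset.sum_nonneg fun i _ => (hq i).nonneg
  have hSM : S ∈ M := sum_mem fun i _ => hqM i
  set h : H →L[ℂ] H := CFC.sqrt S with hh
  have hh0 : 0 ≤ h := CFC.sqrt_nonneg S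
  have hhh : h * h = S := CFC.sqrt_mul_sqrt_self S hS0
  have hstar : star h = h := (IsSelfAdjoint.of_nonneg hh0).star_eq
  have hhM : h ∈ M := by
    refine mem_of_forall_commute M fun y hy => ?_
    have hc : Commute S y := commute_of_mem_commutant hSM hy
    exact hc.cfcₙ_nnreal _
  obtain ⟨s, hsM, hs, hsh, hmin⟩ := exists_range_projection M hhM
  have hnormsq : ∀ x : H →L[ℂ] H, ∀ ξ, ‖x ξ‖ ^ 2 = (inner ℂ ((star x * x) ξ) ξ).re := fun x ξ => by
    rw [ContinuousLinearMap.star_eq_adjoint, mul_apply_eq_comp,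
      ContinuousLinearMap.adjoint_inner_left, inner_self_eq_norm_sq_to_K]
    norm_cast
  -- This is q_i ≤ Σ q_j = h² read on vectors.
  have hle : ∀ i ξ, ‖q i ξ‖ ≤ ‖h ξ‖ := by
    intro i ξ
    refine le_of_sq_le_sq ?_ (norm_nonneg _)
    rw [hnormsq, hnormsq, hstar, hhh, (hq i).isSelfAdjoint.star_eq, (hq i).isIdempotentElem]
    have : 0 ≤ S - q i := by
      rw [hS, ← Finset.sum_erase_add _ _ (Finset.mem_univ i), add_sub_cancel_right]
      exact Finset.sum_nonneg fun i _ => (hq i).nonneg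
    have h2 := ((ContinuousLinearMap.nonneg_iff_isPositive _).1 this).re_inner_nonneg_left ξ
    simp only [sub_apply, inner_sub_left, map_sub, sub_nonneg] at h2
    exact h2
  choose W hWM hWh hWs using fun i => exists_factor M hhM (hqM i) hsM hs hsh hmin (hle i)
  have hqW : ∀ i, q i * W i = W i := fun i => by
    have : (q i * W i - W i) * s = 0 := by
      apply hmin
      rw [sub_mul, mul_assoc, hWh, (hq i).isIdempotentElem, sub_self]
    rwa [sub_mul, mul_assoc, hWs, sub_eq_zero] at this
  have hhV : ∀ i, h * star (W i) = q i := fun i => by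
    have := congrArg star (hWh i)
    rwa [star_mul, hstar, (hq i).isSelfAdjoint.star_eq] at this
  have hss : s * s = s := hs.isIdempotentElem
  have hsstar : star s = s := hs.isSelfAdjoint.star_eq
  have hhs : h * s = h := by
    have := congrArg star hsh
    rwa [star_mul, hstar, hsstar] at this
  have hsum : ∑ i, star (W i) * W i = s := by
    set X := ∑ i, star (W i) * W i - s with hX
    have hXs : X * s = X := by
      simp only [hX, sub_mul, Finset.sum_mul, mul_assoc, hWs, hss]
    have hXstar : star X = X := by
      simp [hX, star_sum, hsstar]
    -- Both terms of h X h equal Σ q_i, and X lives under the range projection s of h, so X = 0.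
    have h1 : h * X * h = 0 := by
      rw [hX, mul_sub, sub_mul, Finset.mul_sum, Finset.sum_mul, hhs, hhh, hS, sub_eq_zero]
      refine Finset.sum_congr rfl fun i _ => ?_
      rw [← mul_assoc, hhV, mul_assoc, hWh, (hq i).isIdempotentElem]
    have h2 : h * X = 0 := by rw [← hXs, ← mul_assoc]; exact hmin _ h1
    have h3 : X * h = 0 := by
      have := congrArg star h2
      rwa [star_mul, hXstar, hstar, star_zero] at this
    exact sub_eq_zero.1 (hXs ▸ hmin _ h3 : X = 0)
  have hsW : ∀ i, s * star (W i) = star (W i) := fun i => by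
    have := congrArg star (hWs i)
    rwa [star_mul, hsstar] at this
  refine ⟨h, s, fun i => star (W i), hhM, hsM, fun i => star_mem (hWM i), hh0, hhh, hs, ?_, ?_,
    hhs, hhV, ?_, by simpa using hsum⟩
  · intro i
    rw [← hhV, ← mul_assoc, hsh]
  · intro y hy
    have : y * h * h = 0 := by
      rw [mul_assoc, hhh, hS, Finset.mul_sum]
      exact Finset.sum_eq_zero fun i _ => hy i
    have := hmin _ this
    rw [mul_assoc, hhs] at this
    exact hmin _ this
  · intro i j
    ext ξ
    rw [star_star]
    -- For fixed j the vectors W_k W_j* ξ lie in the ranges of the q_k and sum to q_j ξ, as does the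
    -- family with single entry q_j ξ at j. Independence identifies the two.
    have := hind (fun k => (W k * star (W j)) ξ - if k = j then q j ξ else 0) ?_ ?_ i
    · rw [sub_eq_zero] at this
      rw [this]
      split_ifs with hij
      · rw [hij]
      · rfl
    · intro k
      have h1 : q k ((W k * star (W j)) ξ) = (W k * star (W j)) ξ :=
        congrArg (fun z : H →L[ℂ] H => z (star (W j) ξ)) (hqW k)
      rw [map_sub, h1]
      split_ifs with hkj
      · subst hkj
        rw [show q k (q k ξ) = q k ξ from
          congrArg (fun z : H →L[ℂ] H => z ξ) (hq k).isIdempotentElem]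
      · rw [map_zero]
    · have h1 : ∑ k, W k * star (W j) = q j := by
        calc ∑ k, W k * star (W j) = h * (∑ k, star (W k) * W k) * star (W j) := by
              rw [Finset.mul_sum, Finset.sum_mul]
              refine Finset.sum_congr rfl fun k _ => ?_
              rw [← mul_assoc, hhV, hqW]
          _ = q j := by rw [hsum, mul_assoc, hsW, hhV]
      rw [Finset.sum_sub_distrib, ← sum_apply, h1]
      simp

end Operators

/-! ### Trace inequalities. -/

section Trace

lemma sum_mul_sum_sub {A ι : Type*} [Ring A] [Fintype ι] {t : A →+ ℝ} {p : ι → A} (hp : ∀ i, p i * p i = p i) :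
    ∑ i, t (p i * (∑ j, p j - p i)) = t ((∑ i, p i) * ∑ i, p i) - t (∑ i, p i) := by
  simp only [mul_sub, hp, map_sub, Finset.sum_sub_distrib]
  rw [← map_sum, ← map_sum, ← Finset.sum_mul]

variable {A : Type*} [Ring A] [StarRing A] [PartialOrder A] [StarOrderedRing A]

/-- The real part of a positive tracial functional. -/
structure IsTrace (t : A →+ ℝ) : Prop where
  nonneg : ∀ x, 0 ≤ x → 0 ≤ t x
  comm : ∀ x y, t (x * y) = t (y * x)
  map_star : ∀ x, t (star x) = t x

/-- The square of the 2-norm associated with `t`. -/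
def normSq (t : A →+ ℝ) (x : A) : ℝ := t (star x * x)

variable {t : A →+ ℝ} (ht : IsTrace t)
include ht

/-- For x = s* s the trace property turns t(x y) into t(s y s*). This lets scalar inequalities be
multiplied under t even when the factors do not commute. -/
lemma IsTrace.mul_nonneg {x y : A} (hx : 0 ≤ x) (hy : 0 ≤ y) : 0 ≤ t (x * y) := by
  rw [StarOrderedRing.nonneg_iff] at hx
  induction hx using AddSubmonoid.closure_induction with
  | mem x hx =>
    obtain ⟨s, rfl⟩ := hx
    simp only
    rw [mul_assoc, ht.comm, mul_assoc]
    exact ht.nonneg _ (by simpa [mul_assoc] using star_right_conjugate_nonneg hy s)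
  | zero => simp
  | add x z _ _ h1 h2 => rw [add_mul, map_add]; exact add_nonneg h1 h2

lemma IsTrace.normSq_nonneg (x : A) : 0 ≤ normSq t x := ht.nonneg _ (star_mul_self_nonneg x)

lemma IsTrace.normSq_add_le (x y : A) :
    normSq t (x + y) ≤ 2 * normSq t x + 2 * normSq t y := by
  have h := ht.normSq_nonneg (x - y)
  simp only [normSq, star_add, star_sub, add_mul, mul_add, sub_mul, mul_sub, map_add, map_sub]
    at h ⊢
  linarith

lemma IsTrace.normSq_sub_le (x y z : A) :
    normSq t (x - z) ≤ 2 * normSq t (x - y) + 2 * normSq t (y - z) := by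
  have := ht.normSq_add_le (x - y) (y - z)
  rwa [sub_add_sub_cancel] at this

/-- 2(1 - b) = (1 - b)² + (1 - b²). -/
lemma IsTrace.mul_one_sub_nonneg {b y : A} (hb : star b = b) (hS : 0 ≤ 1 - b * b) (hy : 0 ≤ y) :
    0 ≤ t (y * (1 - b)) := by
  have h0 : IsSelfAdjoint (1 - b) := by rw [IsSelfAdjoint, star_sub, star_one, hb]
  have h1 := ht.mul_nonneg hy h0.mul_self_nonneg
  have h2 := ht.mul_nonneg hy hS
  simp only [mul_sub, sub_mul, map_sub, mul_one, one_mul] at h1 h2 ⊢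
  linarith

/-- A projection `p` commuting with a self-adjoint contraction `b` such that `b ≥ 1/2` under `p`
and `b ≤ 1/2` under `1 - p`. -/
structure IsHalfProjection (b p : A) : Prop where
  proj : IsStarProjection p
  selfAdjoint : star b = b
  comm : p * b = b * p
  one_sub_sq : 0 ≤ 1 - b * b
  upper : 0 ≤ p * (b + b - 1)
  lower : 0 ≤ (1 - p) * (-(b + b - 1))

omit ht in
-- Under p this is 4b² - 1 = (2b - 1)² + 2(2b - 1) with 2b - 1 ≥ 0; under 1 - p it is 4b² ≥ 0.
lemma IsHalfProjection.le_sq {b p : A} (h : IsHalfProjection b p) :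
    p ≤ 4 • (b * b) := by
  obtain ⟨hp, hb, hc, -, hD, -⟩ := h
  have hpp : p * p = p := hp.isIdempotentElem
  have hc' : ∀ x, p * (b * x) = b * (p * x) := fun x => by
    rw [← mul_assoc, hc, mul_assoc]
  have h1 : 0 ≤ b * (1 - p) * b := by
    have := star_left_conjugate_nonneg hp.one_sub.nonneg b
    rwa [hb] at this
  have h2 : 0 ≤ p * (b + b - 1) * (p * (b + b - 1)) :=
    (IsSelfAdjoint.of_nonneg hD).mul_self_nonneg
  rw [← sub_nonneg]
  have : 4 • (b * b) - p = 4 • (b * (1 - p) * b) + p * (b + b - 1) * (p * (b + b - 1)) +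
      2 • (p * (b + b - 1)) := by
    simp only [mul_sub, mul_add, sub_mul, add_mul, mul_one, mul_assoc, hpp, hc, hc']
    abel
  rw [this]
  exact add_nonneg (add_nonneg (nsmul_nonneg h1 4) h2) (nsmul_nonneg hD 2)

/-- The difference 2b²(1 - b) - (p - b)² is b²(1 - 2b) under 1 - p and (2b - 1)(1 - b²) under p. -/
lemma IsTrace.normSq_half_sub_le {b p : A} (h : IsHalfProjection b p) :
    normSq t (p - b) ≤ 2 * t (b * b * (1 - b)) := by
  obtain ⟨hp, hb, hc, hS, hD, hE⟩ := h
  have hpp : p * p = p := hp.isIdempotentElem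
  have hc' : ∀ x, p * (b * x) = b * (p * x) := fun x => by
    rw [← mul_assoc, hc, mul_assoc]
  have h1 : 0 ≤ t (b * ((1 - p) * (-(b + b - 1))) * b) := by
    have := star_left_conjugate_nonneg hE b
    rw [hb] at this
    exact ht.nonneg _ this
  have h2 := ht.mul_nonneg hD hS
  have : 2 • (b * b * (1 - b)) - star (p - b) * (p - b) =
      b * ((1 - p) * (-(b + b - 1))) * b + p * (b + b - 1) * (1 - b * b) := by
    rw [star_sub, hb, hp.isSelfAdjoint.star_eq]
    simp only [mul_sub, mul_add, sub_mul, add_mul, mul_one, one_mul, mul_assoc, hpp, hc, hc',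
      mul_neg, neg_mul]
    abel
  have := congrArg t this
  rw [map_sub, map_add, map_nsmul, nsmul_eq_mul] at this
  rw [normSq]
  push_cast at this
  linarith

/-- Combine 1 - b² ≤ 2(1 - b), from (1 - b)² ≥ 0, with p ≤ 4b². -/
lemma IsTrace.half_mul_le {b p : A} (h : IsHalfProjection b p) :
    t (p * (1 - b * b)) ≤ 8 * t (b * b * (1 - b)) := by
  have hle := h.le_sq
  obtain ⟨hp, hb, hc, hS, hD, hE⟩ := h
  have h1 := ht.mul_one_sub_nonneg hb hS (sub_nonneg.2 hle)
  have h2 : 0 ≤ t (p * ((1 - b) * (1 - b))) :=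
    ht.mul_nonneg hp.nonneg
      (IsSelfAdjoint.mul_self_nonneg (by rw [IsSelfAdjoint, star_sub, star_one, hb]))
  simp only [mul_sub, sub_mul, map_sub, mul_one, one_mul, smul_mul_assoc, map_nsmul] at h1 h2 ⊢
  rw [nsmul_eq_mul, nsmul_eq_mul] at h1
  push_cast at h1
  linarith

/-- The difference of the two sides is b²(1 - 2b) under 1 - p and (1 - b²) + 2b²(1 - b) under p. -/
lemma IsTrace.le_half {b p : A} (h : IsHalfProjection b p) :
    t (b * b) - 2 * t (b * b * (1 - b)) ≤ t p := by
  obtain ⟨hp, hb, hc, hS, hD, hE⟩ := h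
  have hpp : p * p = p := hp.isIdempotentElem
  have hc' : ∀ x, p * (b * x) = b * (p * x) := fun x => by
    rw [← mul_assoc, hc, mul_assoc]
  have h1 : 0 ≤ t (b * ((1 - p) * (-(b + b - 1))) * b) := by
    have := star_left_conjugate_nonneg hE b
    rw [hb] at this
    exact ht.nonneg _ this
  have h2 := ht.mul_nonneg hp.nonneg hS
  have h3 : 0 ≤ b * p * b := by
    have := star_left_conjugate_nonneg hp.nonneg b
    rwa [hb] at this
  have h4 := ht.mul_one_sub_nonneg hb hS h3
  have : p - b * b + 2 • (b * b * (1 - b)) = b * ((1 - p) * (-(b + b - 1))) * b +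
      p * (1 - b * b) + 2 • (b * p * b * (1 - b)) := by
    simp only [mul_sub, mul_add, sub_mul, add_mul, mul_one, one_mul, mul_assoc, hc, hc',
      mul_neg, neg_mul]
    abel
  have := congrArg t this
  simp only [map_sub, map_add, map_nsmul] at this h1 h2 h4 ⊢
  rw [nsmul_eq_mul, nsmul_eq_mul] at this
  push_cast at this
  linarith

/-- With D = V - q one has V V* - q = D V* + q D*, and each summand has 2-norm at most that of D. -/
lemma IsTrace.normSq_range_sub_le {V q : A} (hq : IsStarProjection q) (hV : star V * V = q) :
    normSq t (V * star V - q) ≤ 4 * normSq t (V - q) := by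
  have hqq : q * q = q := hq.isIdempotentElem
  have hqs : star q = q := hq.isSelfAdjoint.star_eq
  set D := V - q with hD
  have hDs : star D = star V - q := by rw [hD, star_sub, hqs]
  have h0 : t (star D * D * q) ≤ normSq t D := by
    have := ht.mul_nonneg (star_mul_self_nonneg D) hq.one_sub.nonneg
    rw [mul_sub, mul_one, map_sub, sub_nonneg] at this
    exact this
  have h1 : normSq t (D * star V) = t (star D * D * q) := by
    rw [normSq, star_mul, star_star, mul_assoc, ht.comm, ← hV]
    simp only [mul_assoc]
  have h2 : normSq t (q * star D) = t (star D * D * q) := by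
    rw [normSq, star_mul, star_star, hqs, mul_assoc, ← mul_assoc q, hqq, ht.comm, mul_assoc,
      ht.comm]
  have h3 : V * star V - q = D * star V + q * star D := by
    rw [hDs, hD, sub_mul, mul_sub, hqq]; abel
  rw [h3]
  have := ht.normSq_add_le (D * star V) (q * star D)
  linarith

variable {ι : Type*} [Fintype ι] [DecidableEq ι]

/-- Replacing almost orthogonal projections `p i` by the range projections of partial isometries
`V i` costs at most a multiple of the orthogonality defect. -/
lemma IsTrace.orthogonalization_le {p q V : ι → A} {h s : A}
    (hp : ∀ i, IsStarProjection (p i)) (hq : ∀ i, IsStarProjection (q i))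
    (hpq : ∀ i, p i * q i = q i) (h0 : 0 ≤ h) (hh : h * h = ∑ i, q i)
    (hs : IsStarProjection s) (hsp : ∀ i, s * p i = p i) (hhs : h * s = h)
    (hhV : ∀ i, h * V i = q i) (hVV : ∀ i, star (V i) * V i = q i)
    (hsum : ∑ i, V i * star (V i) = s) :
    ∑ i, t (p i) - ∑ i, t (p i * (∑ j, p j - p i)) ≤ t s ∧
    ∑ i, normSq t (V i * star (V i) - p i) ≤ 10 * ∑ i, t (p i * (∑ j, p j - p i)) := by
  set S := ∑ i, p i with hS
  set S' := ∑ i, q i with hS'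
  have hps : ∀ i, star (p i) = p i := fun i => (hp i).isSelfAdjoint.star_eq
  have hqs : ∀ i, star (q i) = q i := fun i => (hq i).isSelfAdjoint.star_eq
  have hpp : ∀ i, p i * p i = p i := fun i => (hp i).isIdempotentElem
  have hqq : ∀ i, q i * q i = q i := fun i => (hq i).isIdempotentElem
  have hss : s * s = s := hs.isIdempotentElem
  have hstar : star s = s := hs.isSelfAdjoint.star_eq
  have hqp : ∀ i, q i * p i = q i := fun i => by
    have := congrArg star (hpq i)
    rwa [star_mul, hps, hqs] at this
  have hδ : ∑ i, t (p i * (S - p i)) = t (S * S) - t S := sum_mul_sum_sub hpp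
  have hδ' : ∑ i, t (q i * (S' - q i)) = t (S' * S') - t S' := sum_mul_sum_sub hqq
  have hsS : s * S = S := by rw [hS, Finset.mul_sum]; exact Finset.sum_congr rfl fun i _ => hsp i
  have hSstar : star S = S := by rw [hS, star_sum]; exact Finset.sum_congr rfl fun i _ => hps i
  have hSs : S * s = S := by
    have := congrArg star hsS
    rwa [star_mul, hSstar, hstar] at this
  have htS : ∑ i, t (p i) = t S := (map_sum t _ _).symm
  have hts : ∑ i, t (q i) = t s := by
    rw [← hsum, map_sum]
    exact Finset.sum_congr rfl fun i _ => by rw [ht.comm, hVV]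
  -- Expand t((S - s)²) ≥ 0 using S s = s S = S.
  have h1 : t S - (t (S * S) - t S) ≤ t s := by
    have := ht.normSq_nonneg (S - s)
    rw [normSq, star_sub, hSstar, hstar, sub_mul, mul_sub, mul_sub, hSs, hsS, hss] at this
    simp only [map_sub] at this
    linarith
  have hpq0 : ∀ i, 0 ≤ p i - q i := fun i => by
    have : star (p i - q i) * (p i - q i) = p i - q i := by
      rw [star_sub, hps, hqs, sub_mul, mul_sub, mul_sub, hpp, hpq, hqp, hqq, sub_self, sub_zero]
    rw [← this]
    exact star_mul_self_nonneg _
  have hpq2 : ∑ i, normSq t (q i - p i) = t S - t s := by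
    rw [← htS, ← hts, ← Finset.sum_sub_distrib]
    refine Finset.sum_congr rfl fun i _ => ?_
    rw [normSq, star_sub, hps, hqs, sub_mul, mul_sub, mul_sub, hpp, hpq, hqp, hqq, sub_self,
      zero_sub, neg_sub, map_sub]
  have herase : ∀ (f : ι → A) i, ∑ j, f j - f i = ∑ j ∈ Finset.univ.erase i, f j := fun f i => by
    rw [← Finset.sum_erase_add _ _ (Finset.mem_univ i), add_sub_cancel_right]
  -- The overlap is monotone: shrinking each p_i to q_i can only decrease it.
  have hδδ : t (S' * S') - t S' ≤ t (S * S) - t S := by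
    rw [← hδ, ← hδ']
    refine Finset.sum_le_sum fun i _ => ?_
    have e1 : 0 ≤ S - p i := by
      rw [hS, herase]; exact Finset.sum_nonneg fun j _ => (hp j).nonneg
    have e2 : 0 ≤ (S - p i) - (S' - q i) := by
      rw [hS, hS', herase, herase, ← Finset.sum_sub_distrib]
      exact Finset.sum_nonneg fun j _ => hpq0 j
    have e3 := ht.mul_nonneg (hpq0 i) e1
    have e4 := ht.mul_nonneg (hq i).nonneg e2
    rw [mul_sub, map_sub] at e4
    rw [sub_mul, map_sub] at e3
    linarith
  have hD : ∑ i, normSq t (V i - q i) = 2 * t (h * h) - 2 * t h := by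
    have e : ∀ i, normSq t (V i - q i) = 2 * t (q i) - 2 * t (h * (V i * star (V i))) := fun i => by
      have hq' : q i = star (V i) * h := by
        rw [← hqs, ← hhV, star_mul, (IsSelfAdjoint.of_nonneg h0).star_eq]
      have e1 : star (V i) * q i = star (V i) * h * V i := by rw [mul_assoc, hhV]
      have e2 : q i * V i = star (V i) * h * V i := by rw [← hq']
      have e3 : t (star (V i) * h * V i) = t (h * (V i * star (V i))) := by
        rw [mul_assoc, ht.comm, mul_assoc]
      rw [normSq, star_sub, hqs, sub_mul, mul_sub, mul_sub, hVV, hqq, e1, e2]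
      simp only [map_sub]
      rw [e3]; ring
    rw [Finset.sum_congr rfl fun i _ => e i, Finset.sum_sub_distrib, ← Finset.mul_sum,
      ← Finset.mul_sum, ← map_sum, ← map_sum, ← Finset.mul_sum, hsum, hhs, hh]
  -- h⁴ - 3h² + 2h = h²(h - 1)² + 2h(h - 1)² ≥ 0.
  have hhle : 2 * t (h * h) - 2 * t h ≤ t (S' * S') - t S' := by
    have hst : star (h - 1) = h - 1 := by
      rw [star_sub, star_one, (IsSelfAdjoint.of_nonneg h0).star_eq]
    have e1 := ht.nonneg _ (star_left_conjugate_nonneg h0 (h - 1))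
    have e2 := ht.nonneg _ (star_left_conjugate_nonneg
      (IsSelfAdjoint.of_nonneg h0).mul_self_nonneg (h - 1))
    rw [← hh]
    rw [hst] at e1 e2
    simp only [sub_mul, mul_sub, one_mul, mul_one, map_sub, mul_assoc] at e1 e2 ⊢
    linarith
  refine ⟨by rw [hδ, htS]; exact h1, ?_⟩
  calc ∑ i, normSq t (V i * star (V i) - p i)
      ≤ ∑ i, (8 * normSq t (V i - q i) + 2 * normSq t (q i - p i)) := by
        refine Finset.sum_le_sum fun i _ => ?_
        have e1 := ht.normSq_sub_le (V i * star (V i)) (q i) (p i)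
        have e2 := ht.normSq_range_sub_le (hq i) (hVV i)
        linarith
    _ ≤ 10 * ∑ i, t (p i * (S - p i)) := by
        rw [Finset.sum_add_distrib, ← Finset.mul_sum, ← Finset.mul_sum, hD, hpq2, hδ]
        linarith

end Trace

/-! ### Rounding the Fourier coefficients to projections. -/

section Rounding

variable {A : Type*} [Ring A] [StarRing A] [PartialOrder A] [StarOrderedRing A]
  {t : A →+ ℝ} {ι : Type*} [Fintype ι] [DecidableEq ι]

omit [StarOrderedRing A] in
-- Terms odd in e vanish since t is invariant under star and cyclic shifts; of the terms with two
-- factors e, those from b e e and e b e cancel.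
lemma IsTrace.map_cubic (ht : IsTrace t) {b e : A} (hb : star b = b) (he : star e = -e) :
    t (star (b + e) * (b + e) * (b + e)) = t ((b * b - e * e) * b) := by
  have h1 : t (b * (b * e)) = 0 := by
    have h := ht.map_star (b * (b * e))
    have h' : star (b * (b * e)) = -(e * (b * b)) := by simp [hb, he, mul_assoc]
    rw [h', map_neg, ht.comm, mul_assoc] at h
    linarith
  have h2 : t (e * (e * e)) = 0 := by
    have h := ht.map_star (e * (e * e))
    have h' : star (e * (e * e)) = -(e * (e * e)) := by simp [he, mul_assoc]
    rw [h', map_neg] at h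
    linarith
  have h3 : t (b * (e * b)) = t (b * (b * e)) := by
    rw [ht.comm, mul_assoc, ht.comm, mul_assoc]
  have h4 : t (e * (b * b)) = t (b * (b * e)) := by rw [ht.comm, mul_assoc]
  have h5 : t (b * (e * e)) = t (e * (e * b)) := by rw [ht.comm, mul_assoc]
  have h6 : t (e * (b * e)) = t (e * (e * b)) := by
    rw [ht.comm, mul_assoc, h5]
  rw [star_add, hb, he]
  simp only [mul_add, add_mul, sub_mul, neg_mul, mul_assoc, map_add, map_sub, map_neg]
  linarith

/-- The spectral projections of the real parts of the Fourier coefficients of an almost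
multiplicative map are close to these coefficients, almost orthogonal, and almost sum up to `1`. -/
lemma IsTrace.rounding (ht : IsTrace t) (ht1 : t 1 = 1) {b e p : ι → A} {ε : ℝ}
    (he : ∀ u, star (e u) = -e u) (hp : ∀ u, IsHalfProjection (b u) (p u))
    (hsum : ∑ u, (b u * b u - e u * e u) = 1)
    (hcub : 1 - ε / 2 ≤ ∑ u, t (star (b u + e u) * (b u + e u) * (b u + e u))) :
    ∑ u, normSq t (p u - (b u + e u)) ≤ 4 * ε ∧
    ∑ u, t (p u * (∑ v, p v - p u)) ≤ 16 * ε ∧ 1 - 2 * ε ≤ ∑ u, t (p u) := by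
  have hb : ∀ u, star (b u) = b u := fun u => (hp u).selfAdjoint
  have hS : ∀ u, 0 ≤ 1 - b u * b u := fun u => (hp u).one_sub_sq
  have hee : ∀ u, 0 ≤ -(e u * e u) := fun u => by
    have := star_mul_self_nonneg (e u)
    rwa [he, neg_mul] at this
  have hbb : ∀ u, 0 ≤ b u * b u := fun u => IsSelfAdjoint.mul_self_nonneg (hb u)
  set Q : ι → A := fun u => b u * b u - e u * e u with hQ
  have hQ0 : ∀ u, 0 ≤ Q u := fun u => by
    have := add_nonneg (hbb u) (hee u)
    rwa [← sub_eq_add_neg] at this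
  have herase : ∀ (f : ι → A) u, ∑ j, f j - f u = ∑ j ∈ Finset.univ.erase u, f j := fun f u => by
    rw [← Finset.sum_erase_add _ _ (Finset.mem_univ u), add_sub_cancel_right]
  have hQ1 : ∀ u, 0 ≤ 1 - Q u := fun u => by
    rw [← hsum, herase]
    exact Finset.sum_nonneg fun v _ => hQ0 v
  have htQ : ∑ u, t (Q u) = 1 := by rw [← map_sum, hsum, ht1]
  have hcub' : 1 - ε / 2 ≤ ∑ u, t (Q u * b u) :=
    hcub.trans_eq (Finset.sum_congr rfl fun u _ => ht.map_cubic (hb u) (he u))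
  -- Replacing b² by Q = b² - e² only increases the trace against 1 - b.
  have hσ : ∑ u, t (b u * b u * (1 - b u)) ≤ ε / 2 := by
    have : ∑ u, t (b u * b u * (1 - b u)) ≤ ∑ u, (t (Q u) - t (Q u * b u)) := by
      refine Finset.sum_le_sum fun u _ => ?_
      have := ht.mul_one_sub_nonneg (hb u) (hS u) (hee u)
      simp only [hQ, mul_sub, sub_mul, map_sub, mul_one, neg_mul, map_neg] at this ⊢
      linarith
    rw [Finset.sum_sub_distrib, htQ] at this
    linarith
  -- Add t((1 - b) Q (1 - b)) ≥ 0 and t(b² (1 - Q)) ≥ 0 to get t(b²) ≥ 2 t(Q b) - t(Q).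
  have hβ : 1 - ε ≤ ∑ u, t (b u * b u) := by
    have : ∑ u, (2 * t (Q u * b u) - t (Q u)) ≤ ∑ u, t (b u * b u) := by
      refine Finset.sum_le_sum fun u _ => ?_
      have h1 : 0 ≤ t ((1 - b u) * Q u * (1 - b u)) := by
        have := star_left_conjugate_nonneg (hQ0 u) (1 - b u)
        rw [star_sub, star_one, hb] at this
        exact ht.nonneg _ this
      have h2 := ht.mul_nonneg (hbb u) (hQ1 u)
      have h3 : t (b u * (Q u * b u)) = t (b u * (b u * Q u)) := by
        rw [ht.comm (b u) (b u * Q u), mul_assoc]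
      have h4 : t (b u * Q u) = t (Q u * b u) := ht.comm _ _
      simp only [mul_sub, sub_mul, map_sub, mul_one, one_mul, mul_assoc] at h1 h2
      linarith
    rw [Finset.sum_sub_distrib, ← Finset.mul_sum, htQ] at this
    linarith
  have hγ : ∑ u, normSq t (e u) ≤ ε := by
    have : ∑ u, normSq t (e u) = 1 - ∑ u, t (b u * b u) := by
      rw [← htQ, ← Finset.sum_sub_distrib]
      refine Finset.sum_congr rfl fun u _ => ?_
      rw [normSq, he, neg_mul, hQ, map_neg, map_sub]
      ring
    linarith
  refine ⟨?_, ?_, ?_⟩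
  · have : ∑ u, normSq t (p u - (b u + e u)) ≤
        ∑ u, (4 * t (b u * b u * (1 - b u)) + 2 * normSq t (e u)) := by
      refine Finset.sum_le_sum fun u _ => ?_
      have h1 := ht.normSq_sub_le (p u) (b u) (b u + e u)
      have h2 := ht.normSq_half_sub_le (hp u)
      have h3 : normSq t (b u - (b u + e u)) = normSq t (e u) := by
        rw [sub_add_cancel_left, normSq, normSq, star_neg, neg_mul_neg]
      linarith
    rw [Finset.sum_add_distrib, ← Finset.mul_sum, ← Finset.mul_sum] at this
    linarith
  · have : ∑ u, t (p u * (∑ v, p v - p u)) ≤ ∑ u, 32 * t (b u * b u * (1 - b u)) := by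
      refine Finset.sum_le_sum fun u _ => ?_
      -- Σ_{v≠u} p_v ≤ 4 Σ_{v≠u} Q_v = 4(1 - Q_u) ≤ 4(1 - b_u²).
      have h1 : 0 ≤ 4 • (1 - b u * b u) - (∑ v, p v - p u) := by
        have h2 : ∑ v, p v - p u ≤ 4 • (1 - Q u) := by
          rw [← hsum, herase, herase Q, Finset.smul_sum]
          refine Finset.sum_le_sum fun v _ => (hp v).le_sq.trans (nsmul_le_nsmul_right ?_ 4)
          rw [hQ, ← sub_nonneg, sub_sub_cancel_left]
          exact hee v
        refine sub_nonneg.2 (h2.trans (nsmul_le_nsmul_right ?_ 4))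
        have h3 : 1 - b u * b u - (1 - Q u) = -(e u * e u) := by simp only [hQ]; abel
        rw [← sub_nonneg, h3]
        exact hee u
      have h2 := ht.mul_nonneg (hp u).proj.nonneg h1
      rw [mul_sub, map_sub, mul_smul_comm, map_nsmul, nsmul_eq_mul] at h2
      push_cast at h2
      have h3 := ht.half_mul_le (hp u)
      linarith
    rw [← Finset.mul_sum] at this
    linarith
  · have : ∑ u, (t (b u * b u) - 2 * t (b u * b u * (1 - b u))) ≤ ∑ u, t (p u) :=
      Finset.sum_le_sum fun u _ => ht.le_half (hp u)
    rw [Finset.sum_sub_distrib, ← Finset.mul_sum] at this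
    linarith

end Rounding

/-! ### Operator-valued Fourier analysis on ℤ₂ᵏ. -/

section Fourier

variable {k : ℕ}

lemma sign_add_right (u x y : Fin k → ZMod 2) : sign u (x + y) = sign u x * sign u y := by
  have h : ∀ a b : ZMod 2, ((-1 : ℂ)) ^ (a + b).val = (-1) ^ a.val * (-1) ^ b.val := by
    intro a b
    rw [← pow_add, neg_one_pow_eq_pow_mod_two, neg_one_pow_eq_pow_mod_two (a.val + b.val),
      ZMod.val_add, Nat.mod_mod]
  rw [sign, dotProduct_add, h, sign, sign]

lemma sign_comm (u x : Fin k → ZMod 2) : sign u x = sign x u := by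
  rw [sign, sign, dotProduct_comm]

lemma sign_add_left (u v x : Fin k → ZMod 2) : sign (u + v) x = sign u x * sign v x := by
  rw [sign_comm, sign_add_right, sign_comm x u, sign_comm x v]

lemma star_sign (u x : Fin k → ZMod 2) : star (sign u x) = sign u x := by
  simp [sign]

lemma sum_sign (u : Fin k → ZMod 2) :
    ∑ x, sign u x = if u = 0 then (Fintype.card (Fin k → ZMod 2) : ℂ) else 0 := by
  split_ifs with hu
  · subst hu; simp [sign]
  · obtain ⟨i, hi⟩ := Function.ne_iff.1 hu
    have hi1 : u i = 1 := by
      have : ∀ a : ZMod 2, a ≠ 0 → a = 1 := by decide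
      exact this _ hi
    have hs : sign u (Pi.single i 1) = -1 := by
      rw [sign, dotProduct_single, hi1, mul_one, ZMod.val_one, pow_one]
    -- Translation by a basis vector on which the character is -1 negates the sum.
    have := Equiv.sum_comp (Equiv.addRight (Pi.single i (1 : ZMod 2))) (sign u)
    simp only [Equiv.coe_addRight, sign_add_right, hs, mul_neg_one, Finset.sum_neg_distrib] at this
    exact self_eq_neg.1 this.symm

lemma sum_sign_mul_sign (u v : Fin k → ZMod 2) :
    ∑ x, sign u x * sign v x = if u = v then (Fintype.card (Fin k → ZMod 2) : ℂ) else 0 := by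
  simp only [← sign_add_left, sum_sign]
  refine if_congr ?_ rfl rfl
  rw [← sub_eq_zero (b := v)]
  have : u - v = u + v := by
    ext i
    rw [Pi.sub_apply, Pi.add_apply, CharTwo.sub_eq_add]
  rw [this]

variable {A : Type*} [Ring A] [StarRing A] [Module ℂ A] [IsScalarTower ℂ A A]
  [SMulCommClass ℂ A A] [StarModule ℂ A]

/-- The Fourier coefficients of a function on `ℤ₂ᵏ`. -/
noncomputable def fourierCoeff (f : (Fin k → ZMod 2) → A) (u : Fin k → ZMod 2) : A :=
  (Fintype.card (Fin k → ZMod 2) : ℂ)⁻¹ • ∑ x, sign u x • f x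

omit [StarRing A] [IsScalarTower ℂ A A] [SMulCommClass ℂ A A] [StarModule ℂ A] in
lemma card_smul_fourierCoeff (f : (Fin k → ZMod 2) → A) (u : Fin k → ZMod 2) :
    Fintype.card (Fin k → ZMod 2) • fourierCoeff f u = ∑ x, sign u x • f x := by
  rw [fourierCoeff, ← Nat.cast_smul_eq_nsmul ℂ, smul_inv_smul₀]
  exact_mod_cast Fintype.card_ne_zero

omit [StarRing A] [IsScalarTower ℂ A A] [SMulCommClass ℂ A A] [StarModule ℂ A] in
lemma sum_sign_smul_fourierCoeff (f : (Fin k → ZMod 2) → A) (x : Fin k → ZMod 2) :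
    ∑ u, sign u x • fourierCoeff f u = f x := by
  have hN : (Fintype.card (Fin k → ZMod 2) : ℂ) ≠ 0 := by exact_mod_cast Fintype.card_ne_zero
  calc ∑ u, sign u x • fourierCoeff f u
      = (Fintype.card (Fin k → ZMod 2) : ℂ)⁻¹ • ∑ y, (∑ u, sign x u * sign y u) • f y := by
        simp only [fourierCoeff, Finset.smul_sum, Finset.sum_smul]
        rw [Finset.sum_comm]
        refine Finset.sum_congr rfl fun y _ => Finset.sum_congr rfl fun u _ => ?_
        rw [smul_comm, smul_smul, smul_smul, smul_smul, sign_comm u x, sign_comm u y, mul_assoc]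
    _ = f x := by
        simp only [sum_sign_mul_sign, ite_smul, zero_smul, Finset.sum_ite_eq, Finset.mem_univ,
          if_true]
        rw [inv_smul_smul₀ hN]

lemma parseval (c d : (Fin k → ZMod 2) → A) :
    ∑ x, star (∑ u, sign u x • c u) * ∑ v, sign v x • d v =
      Fintype.card (Fin k → ZMod 2) • ∑ u, star (c u) * d u := by
  calc ∑ x, star (∑ u, sign u x • c u) * ∑ v, sign v x • d v
      = ∑ u, ∑ v, (∑ x, sign u x * sign v x) • (star (c u) * d v) := by
        simp only [star_sum, star_smul, star_sign, Finset.sum_mul_sum, Finset.sum_smul,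
          smul_mul_smul_comm]
        rw [Finset.sum_comm]
        exact Finset.sum_congr rfl fun u _ => Finset.sum_comm
    _ = _ := by
        simp only [sum_sign_mul_sign, ite_smul, zero_smul, Finset.sum_ite_eq, Finset.mem_univ,
          if_true, Nat.cast_smul_eq_nsmul, Finset.smul_sum]

lemma sum_fourierCoeff_cubic (f : (Fin k → ZMod 2) → A) :
    ∑ x, ∑ y, star (f (x + y)) * (f x * f y) =
      (Fintype.card (Fin k → ZMod 2) * Fintype.card (Fin k → ZMod 2)) •
        ∑ u, star (fourierCoeff f u) * fourierCoeff f u * fourierCoeff f u := by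
  set a := fourierCoeff f with ha
  have h1 : ∀ x, ∑ y, star (f (x + y)) * (f x * f y) =
      Fintype.card (Fin k → ZMod 2) • ∑ u, star (a u) * (sign u x • f x) * a u := by
    intro x
    -- For fixed x, the function y ↦ φ(x)* φ(x+y) has coefficients (-1)^{u·x} φ(x)* a_u. Summing
    -- over x afterwards produces the remaining factor a_u.
    have := parseval (fun u => star (f x) * (sign u x • a u)) a
    have h2 : ∀ y, ∑ u, sign u y • (star (f x) * (sign u x • a u)) = star (f x) * f (x + y) := by
      intro y
      rw [← sum_sign_smul_fourierCoeff f (x + y), Finset.mul_sum]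
      refine Finset.sum_congr rfl fun u _ => ?_
      rw [mul_smul_comm, mul_smul_comm, smul_smul, sign_add_right, mul_comm]
    have h3 : ∀ y, ∑ u, sign u y • a u = f y := sum_sign_smul_fourierCoeff f
    simp only [h2, h3] at this
    simpa only [star_mul, star_star, star_smul, star_sign, smul_mul_assoc, mul_smul_comm,
      mul_assoc] using this
  simp only [h1, ← Finset.smul_sum]
  rw [Finset.sum_comm, mul_smul]
  congr 1
  rw [Finset.smul_sum]
  refine Finset.sum_congr rfl fun u _ => ?_
  rw [← Finset.sum_mul, ← Finset.mul_sum, ← card_smul_fourierCoeff, mul_smul_comm, smul_mul_assoc]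

end Fourier

/-! ### Tracial von Neumann algebras and the conclusion. -/

section VonNeumann

variable {H : Type*} [NormedAddCommGroup H] [InnerProductSpace ℂ H] [CompleteSpace H]

instance instStarOrderedRing (M : VonNeumannAlgebra H) : StarOrderedRing M := by
  refine StarOrderedRing.of_nonneg_iff' (fun {x y} h z => ?_) fun x => ⟨fun h => ?_, ?_⟩
  · exact add_le_add_right (α := H →L[ℂ] H) h z.1
  · have h0 : 0 ≤ (x : H →L[ℂ] H) := h
    refine ⟨⟨CFC.sqrt x.1, mem_of_forall_commute M fun y hy => ?_⟩, Subtype.ext ?_⟩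
    · have hc : Commute x.1 y := commute_of_mem_commutant x.2 hy
      exact hc.cfcₙ_nnreal _
    · change x.1 = star (CFC.sqrt x.1) * CFC.sqrt x.1
      rw [(IsSelfAdjoint.of_nonneg (CFC.sqrt_nonneg x.1)).star_eq, CFC.sqrt_mul_sqrt_self x.1 h0]
  · rintro ⟨s, rfl⟩
    exact star_mul_self_nonneg (s : H →L[ℂ] H)

instance instIsScalarTower (M : VonNeumannAlgebra H) : IsScalarTower ℂ M M :=
  ⟨fun c x y => Subtype.ext (smul_mul_assoc c x.1 y.1)⟩

instance instSMulCommClass (M : VonNeumannAlgebra H) : SMulCommClass ℂ M M :=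
  ⟨fun c x y => Subtype.ext (mul_smul_comm c x.1 y.1).symm⟩

instance instStarModule (M : VonNeumannAlgebra H) : StarModule ℂ M :=
  ⟨fun c x => Subtype.ext (star_smul c x.1)⟩

lemma isStarProjection_coe {M : VonNeumannAlgebra H} {p : M} :
    IsStarProjection (p : H →L[ℂ] H) ↔ IsStarProjection p :=
  ⟨fun h => ⟨Subtype.ext h.isIdempotentElem, Subtype.ext h.isSelfAdjoint⟩,
    fun h => ⟨congrArg Subtype.val h.isIdempotentElem, congrArg Subtype.val h.isSelfAdjoint⟩⟩

/-- The real part of a linear functional, as an additive map. -/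
noncomputable def reFunctional (M : VonNeumannAlgebra H) (τ : M →ₗ[ℂ] ℂ) : M →+ ℝ :=
  Complex.reAddGroupHom.comp τ.toAddMonoidHom

lemma isTrace_reFunctional {M : VonNeumannAlgebra H} {τ : M →ₗ[ℂ] ℂ}
    (hτ : IsNormalFaithfulTracialState M τ) : IsTrace (reFunctional M τ) where
  nonneg x hx := (Complex.le_def.1 (hτ.nonneg x hx)).1
  comm x y := congrArg Complex.re (hτ.tracial x y)
  map_star x := by
    have hreal : ∀ y : M, star y = y → (τ y).im = 0 := by
      intro y hy
      -- τ((y + 1)²) and τ(y²) are real and differ by 2τ(y) + 1.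
      have h1 := (Complex.le_def.1 (hτ.nonneg _ (star_mul_self_nonneg (y + 1)))).2
      have h2 := (Complex.le_def.1 (hτ.nonneg _ (star_mul_self_nonneg y))).2
      simp only [star_add, star_one, hy, add_mul, mul_add, mul_one, one_mul, map_add, hτ.map_one,
        Complex.add_im, Complex.one_im, Complex.zero_im] at h1 h2
      linarith
    have h := hreal (Complex.I • (x - star x)) (by
      rw [star_smul, star_sub, star_star, Complex.star_def, Complex.conj_I, neg_smul, ← smul_neg,
        neg_sub])
    rw [map_smul, map_sub, smul_eq_mul] at h
    simp at h
    change (τ (star x)).re = (τ x).re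
    linarith

lemma tauNorm_sq {M : VonNeumannAlgebra H} {τ : M →ₗ[ℂ] ℂ}
    (hτ : IsNormalFaithfulTracialState M τ) (x : M) :
    tauNorm M τ x ^ 2 = normSq (reFunctional M τ) x :=
  Real.sq_sqrt ((isTrace_reFunctional hτ).normSq_nonneg x)

lemma exists_halfProjection (M : VonNeumannAlgebra H) {b : M} (hb : star b = b)
    (hS : 0 ≤ 1 - b * b) : ∃ p : M, IsHalfProjection b p := by
  -- The positive part of 2b - 1 corresponds to the spectrum of b above 1/2.
  set x : M := b + b - 1 with hx
  have hxs : IsSelfAdjoint x.1 :=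
    congrArg Subtype.val (show star x = x by rw [hx, star_sub, star_add, star_one, hb])
  obtain ⟨p, hpM, hp, hc, h1, h2⟩ := exists_positive_projection M x.2 hxs
  lift p to M using hpM
  refine ⟨p, isStarProjection_coe.1 hp, hb, ?_, hS, h1, h2⟩
  have hc' : p * x = x * p := Subtype.ext hc
  have h3 : p * b + p * b = b * p + b * p := by
    simpa [hx, mul_sub, sub_mul, mul_add, add_mul] using hc'
  have h4 : (2 : ℂ) • (p * b) = (2 : ℂ) • (b * p) := by rw [two_smul, two_smul, h3]
  have := congrArg (fun y => (2 : ℂ)⁻¹ • y) h4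
  simpa [smul_smul] using this

/-- Almost orthogonal projections are close to orthogonal ones. -/
lemma exists_orthogonal_projections {M : VonNeumannAlgebra H} {t : M →+ ℝ} (ht : IsTrace t)
    {ι : Type*} [Fintype ι] [DecidableEq ι] (p : ι → M) (hp : ∀ i, IsStarProjection (p i)) :
    ∃ q : ι → M, (∀ i, IsStarProjection (q i)) ∧ IsStarProjection (∑ i, q i) ∧
      (∀ i, q i * ∑ j, q j = q i) ∧
      ∑ i, t (p i) - ∑ i, t (p i * (∑ j, p j - p i)) ≤ t (∑ i, q i) ∧
      ∑ i, normSq t (q i - p i) ≤ 10 * ∑ i, t (p i * (∑ j, p j - p i)) := by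
  obtain ⟨q, hqM, hq, hpq, hind, hspan⟩ := exists_independent_subprojections M
    (fun i => (p i : H →L[ℂ] H)) (fun i => (p i).2) (fun i => isStarProjection_coe.2 (hp i))
    Finset.univ
  obtain ⟨h, s, V, hhM, hsM, hVM, h0, hh, hs, hsq, -, hhs, hhV, hVV, hsum⟩ :=
    exists_polar M q hqM hq fun η h1 h2 i => hind η h1 h2 i (Finset.mem_univ i)
  have hsp : ∀ i, s * (p i : H →L[ℂ] H) = p i := fun i => by
    have := hspan (1 - s) (fun i _ => by rw [sub_mul, one_mul, hsq, sub_self]) i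
      (Finset.mem_univ i)
    rw [sub_mul, one_mul, sub_eq_zero] at this
    exact this.symm
  lift h to M using hhM
  lift s to M using hsM
  lift q to ι → M using hqM
  lift V to ι → M using hVM
  have hVV₂ : ∀ i j, star (V i) * V j = if i = j then q i else 0 := fun i j =>
    Subtype.ext ((hVV i j).trans (by split_ifs <;> rfl))
  have hVV' : ∀ i, star (V i) * V i = q i := fun i => by rw [hVV₂, if_pos rfl]
  have hsum' : ∑ i, V i * star (V i) = s := Subtype.ext (by simpa using hsum)
  have hs' : IsStarProjection s := isStarProjection_coe.1 hs
  have hq' : ∀ i, IsStarProjection (q i) := fun i => isStarProjection_coe.1 (hq i)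
  obtain ⟨h1, h2⟩ := ht.orthogonalization_le (h := h) (s := s) (V := V) hp hq'
    (fun i => Subtype.ext (hpq i)) h0
    (Subtype.ext (by simpa using hh)) hs' (fun i => Subtype.ext (hsp i)) (Subtype.ext hhs)
    (fun i => Subtype.ext (hhV i)) hVV' hsum'
  have hVq : ∀ i, V i * q i = V i := fun i => by
    have hqq : q i * q i = q i := (hq' i).isIdempotentElem
    have h3 : star (V i - V i * q i) * (V i - V i * q i) = 0 := by
      rw [star_sub, star_mul, (hq' i).isSelfAdjoint.star_eq, sub_mul, mul_sub, mul_sub,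
        ← mul_assoc, hVV', mul_assoc (q i), hVV', mul_assoc (q i), ← mul_assoc (star (V i)), hVV',
        hqq, hqq, sub_self]
    have h5 := CStarRing.star_mul_self_eq_zero_iff _ |>.1 (congrArg Subtype.val h3)
    exact (sub_eq_zero.1 (Subtype.ext h5 : V i - V i * q i = 0)).symm
  refine ⟨fun i => V i * star (V i), fun i => ⟨?_, IsSelfAdjoint.mul_star_self (V i)⟩,
    hsum'.symm ▸ hs', fun i => ?_, hsum'.symm ▸ h1, h2⟩
  · rw [IsIdempotentElem, mul_assoc, ← mul_assoc (star (V i)), hVV', ← mul_assoc, hVq]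
  · simp only [Finset.mul_sum]
    rw [Finset.sum_eq_single i]
    · rw [mul_assoc, ← mul_assoc (star (V i)), hVV', ← mul_assoc, hVq]
    · intro j _ hj
      rw [mul_assoc, ← mul_assoc (star (V i)), hVV₂, if_neg hj.symm, zero_mul, mul_zero]
    · simp

lemma exists_projectiveMeasurement_of_almost_multiplicative {M : VonNeumannAlgebra H} {τ : M →ₗ[ℂ] ℂ}
    (hτ : IsNormalFaithfulTracialState M τ) {k : ℕ} (φ : (Fin k → ZMod 2) → unitary M) {ε : ℝ}
    (hφ : 𝔼 x, 𝔼 y, tauNorm M τ ((φ x : M) * (φ y : M) - (φ (x + y) : M)) ^ 2 ≤ ε) :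
    ∃ P : (Fin k → ZMod 2) → M, IsProjectiveMeasurement M P ∧
      𝔼 x, tauNorm M τ ((φ x : M) - observable M P x) ^ 2 ≤ 692 * ε := by
  set t := reFunctional M τ with htdef
  have ht : IsTrace t := isTrace_reFunctional hτ
  have ht1 : t 1 = 1 := by
    change (τ 1).re = 1
    rw [hτ.map_one, Complex.one_re]
  set N := Fintype.card (Fin k → ZMod 2) with hN
  have hN0 : (0 : ℝ) < N := by exact_mod_cast Fintype.card_pos
  set f : (Fin k → ZMod 2) → M := fun x => (φ x : M) with hf
  have hff : ∀ x, star (f x) * f x = 1 := fun x => Unitary.coe_star_mul_self (φ x)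
  have hff' : ∀ x, f x * star (f x) = 1 := fun x => Unitary.coe_mul_star_self (φ x)
  set a := fourierCoeff f with ha
  have hinv : ∀ x, ∑ u, sign u x • a u = f x := sum_sign_smul_fourierCoeff f
  have hcancel : ∀ {x y : M} {n : ℕ}, n ≠ 0 → n • x = n • y → x = y := by
    intro x y n hn h
    rw [← Nat.cast_smul_eq_nsmul ℂ, ← Nat.cast_smul_eq_nsmul ℂ] at h
    have := congrArg (fun z => (n : ℂ)⁻¹ • z) h
    simpa [smul_smul, hn] using this
  have hN0' : N ≠ 0 := Fintype.card_ne_zero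
  have hP1 : ∑ u, star (a u) * a u = 1 := by
    refine hcancel hN0' ?_
    rw [← parseval]
    simp [hinv, hff, hN]
  have hP2 : ∑ u, a u * star (a u) = 1 := by
    refine hcancel hN0' ?_
    have hinv' : ∀ x, ∑ u, sign u x • star (a u) = star (f x) := fun x => by
      rw [← hinv, star_sum]
      exact Finset.sum_congr rfl fun u _ => by rw [star_smul, star_sign]
    have := parseval (fun u => star (a u)) (fun u => star (a u))
    simp only [star_star, hinv', hff'] at this
    rw [← this]
    simp [hN]
  have hcub : 1 - ε / 2 ≤ ∑ u, t (star (a u) * a u * a u) := by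
    have h1 : ∀ x y, tauNorm M τ (f x * f y - f (x + y)) ^ 2 =
        2 - 2 * t (star (f (x + y)) * (f x * f y)) := by
      intro x y
      have e1 : star (f x * f y) * (f x * f y) = 1 := by
        rw [star_mul, mul_assoc, ← mul_assoc _ (f x), hff, one_mul, hff]
      have e2 : t (star (f x * f y) * f (x + y)) = t (star (f (x + y)) * (f x * f y)) := by
        rw [← ht.map_star, star_mul, star_star]
      rw [tauNorm_sq hτ, ← htdef, normSq, star_sub, sub_mul, mul_sub, mul_sub, e1, hff]
      simp only [map_sub, e2, ht1]
      ring
    have h2 : ∑ x, ∑ y, t (star (f (x + y)) * (f x * f y)) =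
        N * N * ∑ u, t (star (a u) * a u * a u) := by
      have := congrArg t (sum_fourierCoeff_cubic f)
      rw [map_nsmul, nsmul_eq_mul, ← hN, ← ha] at this
      simp only [map_sum] at this
      rw [this, Nat.cast_mul]
    have h3 : ∑ x, ∑ y, tauNorm M τ (f x * f y - f (x + y)) ^ 2 ≤ ε * N * N := by
      simp only [Fintype.expect_eq_sum_div_card, ← hN, ← Finset.sum_div] at hφ
      rwa [div_div, div_le_iff₀ (by positivity), ← mul_assoc] at hφ
    simp only [h1, Finset.sum_sub_distrib, ← Finset.mul_sum, h2, Finset.sum_const,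
      Finset.card_univ, ← hN, nsmul_eq_mul] at h3
    have : (N * N : ℝ) * (2 - 2 * ∑ u, t (star (a u) * a u * a u)) ≤ N * N * ε := by linarith
    have := le_of_mul_le_mul_left this (by positivity)
    linarith
  set b : (Fin k → ZMod 2) → M := fun u => (2 : ℂ)⁻¹ • (a u + star (a u)) with hbdef
  set e : (Fin k → ZMod 2) → M := fun u => (2 : ℂ)⁻¹ • (a u - star (a u)) with hedef
  have hbe : ∀ u, b u + e u = a u := fun u => by
    rw [hbdef, hedef]
    simp only
    rw [← smul_add, add_add_sub_cancel, ← two_smul ℂ (a u), smul_smul, inv_mul_cancel₀ two_ne_zero,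
      one_smul]
  have h2star : star (2 : ℂ)⁻¹ = (2 : ℂ)⁻¹ := by simp
  have hb : ∀ u, star (b u) = b u := fun u => by
    simp only [hbdef]
    rw [star_smul, h2star, star_add, star_star, add_comm]
  have he : ∀ u, star (e u) = -e u := fun u => by
    simp only [hedef]
    rw [star_smul, h2star, star_sub, star_star, ← smul_neg, neg_sub]
  -- a* a + a a* = 2(b² - e²), so this is the mean of the two Parseval identities.
  have hsum : ∑ u, (b u * b u - e u * e u) = 1 := by
    refine hcancel (n := 2) two_ne_zero ?_
    rw [Finset.smul_sum, two_nsmul (1 : M)]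
    nth_rewrite 1 [← hP1]
    rw [← hP2, ← Finset.sum_add_distrib]
    refine Finset.sum_congr rfl fun u _ => ?_
    rw [← hbe u, star_add, hb, he]
    noncomm_ring
  have hS : ∀ u, 0 ≤ 1 - b u * b u := by
    intro u
    have hee : ∀ u, 0 ≤ -(e u * e u) := fun u => by
      have := star_mul_self_nonneg (e u)
      rwa [he, neg_mul] at this
    have h1 : 1 - b u * b u =
        ∑ v ∈ Finset.univ.erase u, (b v * b v - e v * e v) + -(e u * e u) := by
      rw [← hsum, ← Finset.sum_erase_add _ _ (Finset.mem_univ u)]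
      abel
    rw [h1]
    refine add_nonneg (Finset.sum_nonneg fun v _ => ?_) (hee u)
    rw [sub_eq_add_neg]
    exact add_nonneg (IsSelfAdjoint.mul_self_nonneg (hb v)) (hee v)
  choose p hp using fun u => exists_halfProjection M (hb u) (hS u)
  obtain ⟨r1, r2, r3⟩ := ht.rounding ht1 he hp hsum (by simpa only [hbe] using hcub)
  obtain ⟨q, hq, hs, hqs, o1, o2⟩ := exists_orthogonal_projections ht p fun u => (hp u).proj
  set s := ∑ u, q u with hsdef
  -- The defect 1 - s is orthogonal to every q_u, so it may be added to any one outcome; 0 is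
  -- chosen.
  let P : (Fin k → ZMod 2) → M := fun u => q u + if u = 0 then 1 - s else 0
  have hPproj : ∀ u, IsStarProjection (P u) := by
    intro u
    by_cases hu : u = 0
    · simp only [P, hu, if_true]
      refine (hq 0).add hs.one_sub ?_
      rw [mul_sub, mul_one, hqs, sub_self]
    · simpa [P, hu] using hq u
  have hPsum : ∑ u, P u = 1 := by
    simp [P, Finset.sum_add_distrib, ← hsdef]
  refine ⟨P, ⟨⟨fun u => (hPproj u).nonneg, hPsum⟩, hPproj⟩, ?_⟩
  have hfin : ∑ x, tauNorm M τ (f x - observable M P x) ^ 2 = N * ∑ u, normSq t (P u - a u) := by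
    have h1 := congrArg t (parseval (fun u => P u - a u) (fun u => P u - a u))
    rw [map_nsmul, nsmul_eq_mul, ← hN] at h1
    simp only [map_sum] at h1
    simp only [normSq]
    rw [← h1]
    refine Finset.sum_congr rfl fun x _ => ?_
    have h2 : ∑ u, sign u x • (P u - a u) = -(f x - observable M P x) := by
      simp only [smul_sub, Finset.sum_sub_distrib, hinv, observable, neg_sub]
    rw [h2, star_neg, neg_mul_neg, tauNorm_sq hτ, normSq]
  -- Here 1 - t(s) ≤ 2ε + 16ε, so the total is 2·18ε + 4·(10·16ε) + 4·4ε = 692ε.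
  have hbound : ∑ u, normSq t (P u - a u) ≤ 692 * ε := by
    have h1 : ∀ u, normSq t (P u - a u) ≤ (if u = 0 then 2 * (1 - t s) else 0) +
        (4 * normSq t (q u - p u) + 4 * normSq t (p u - a u)) := by
      intro u
      have e1 := ht.normSq_sub_le (P u) (q u) (a u)
      have e2 := ht.normSq_sub_le (q u) (p u) (a u)
      have e3 : 2 * normSq t (P u - q u) = if u = 0 then 2 * (1 - t s) else 0 := by
        simp only [P, add_sub_cancel_left]
        split_ifs
        · rw [normSq, hs.one_sub.isSelfAdjoint.star_eq, hs.one_sub.isIdempotentElem, map_sub, ht1]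
        · simp [normSq]
      linarith
    have h2 := Finset.sum_le_sum fun u (_ : u ∈ Finset.univ) => h1 u
    simp only [Finset.sum_add_distrib, ← Finset.mul_sum, Finset.sum_ite_eq', Finset.mem_univ,
      if_true] at h2
    simp only [hbe] at r1
    linarith
  rw [Fintype.expect_eq_sum_div_card, ← hN, div_le_iff₀ hN0]
  calc _ = N * ∑ u, normSq t (P u - a u) := hfin
    _ ≤ 692 * ε * N := by
      rw [mul_comm]
      exact mul_le_mul_of_nonneg_right hbound hN0.le

end VonNeumann

end LinTest

theorem mainTheorem8 :
    ∃ C : ℝ, 0 < C ∧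
      ∀ (H : Type*) [NormedAddCommGroup H] [InnerProductSpace ℂ H] [CompleteSpace H]
        (M : VonNeumannAlgebra H) (τ : M →ₗ[ℂ] ℂ),
        LinTest.IsNormalFaithfulTracialState M τ →
        ∀ (k : ℕ) (φ : (Fin k → ZMod 2) → unitary M) (ε : ℝ),
          𝔼 x, 𝔼 y, LinTest.tauNorm M τ ((φ x : M) * (φ y : M) - (φ (x + y) : M)) ^ 2 ≤ ε →
          ∃ P : (Fin k → ZMod 2) → M, LinTest.IsProjectiveMeasurement M P ∧
            𝔼 x, LinTest.tauNorm M τ ((φ x : M) - LinTest.observable M P x) ^ 2 ≤ C * ε :=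
  ⟨692, by norm_num, fun _ _ _ _ _ _ hτ _ φ _ hφ => LinTest.exists_projectiveMeasurement_of_almost_multiplicative hτ φ hφ⟩
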